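/- Let $n\ge 2$ and $\mathcal V=\{v_1,\dots,v_n\}$. For $k=0,1,2,\dots$ let $\mathcal G_d[k]=(\mathcal V,\mathcal E[k])$ be a digraph without self-edges; let $\mathcal N_j^+[k]$ be the set of out-neighbours of $v_j$ in $\mathcal G_d[k]$ (the nodes to which $v_j$ can transmit) and $\mathcal D_j^+[k]=|\mathcal N_j^+[k]|$. Assume: ($A_1$) at each step $k$ every node $v_j$ knows $\mathcal N_j^+[k]$ and $\mathcal D_j^+[k]$; ($A_2$) there are a strongly connected digraph $\mathcal G_d$ on $\mathcal V$ (the nominal digraph), an integer $l$ and times $0=t_0<t_1<t_2<\cdots$ with $t_{m+1}-t_m<l$ such that for every $m\ge 0$ the union of $\mathcal G_d[t_m],\dots,\mathcal G_d[t_{m+1}-1]$ equals $\mathcal G_d$. Every node $v_j$ has an initial state $y_j[0]\in\mathbb Z$. Put $q=\frac1n\sum_{j} y_j[0]$ and $$y^{init}=\sum_{j:\,y_j[0]>\lceil q\rceil}(y_j[0]-\lceil q\rceil)+\sum_{j:\,y_j[0]<\lfloor q\rfloor}(\lfloor q\rfloor-y_j[0]).$$ The nodes run the following algorithm. Initially $v_j$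 doubles its mass: its mass variables at step $0$ are $(2y_j[0],\,2)$. At step $k$, let $(y,z)$ be the current mass variables of $v_j$. If $z>1$, then $v_j$ sets its state $q^s_j[k]=\lfloor y/z\rfloor$ and splits $y$ into $z$ integer pieces. With $\delta=\lfloor y/z\rfloor$ and $r=y-\delta z$, the first $r$ pieces equal $\delta+1$ and the other $z-r$ pieces equal $\delta$. It keeps the last piece (of size $\delta$), and it sends each of the first $z-1$ pieces to a node drawn from $\mathcal N_j^+[k]\cup\{v_j\}$, each of these nodes having probability $1/(1+\mathcal D_j^+[k])$. All draws, over all nodes, steps and pieces, are independent. If $z\le 1$, then $v_j$ keeps its mass and its state is unchanged: $q^s_j[k]=q^s_j[k-1]$. The mass variables of $v_j$ at step $k+1$ are the sum of the pieces that it kept, sent to itself or received at step $k$, and the number of these pieces. Then for every $0<\varepsilon<1$ there is an integer $k_0\ge 0$ such that, with probability at least $(1-\varepsilon)^{y^{init}+n}$, every node $v_j\in\mathcal V$ satisfies $$\bigl(q^s_j[k]=\lfloor q\rfloor\ \text{ for all } k\ge k_0\bigr)\quad\text{or}\quad\bigl(q^s_j[k]=\lceil q\rceil\ \text{ for all } k\ge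 k_0\bigr).$$ -/

import Mathlib

open MeasureTheory ProbabilityTheory

namespace QuantAvg

variable {n : ℕ}

/-! ### Digraphs

`G.Adj j l` means that there is an edge from `j` to `l`: node `j` can transmit to node `l`. -/

open Classical in
/-- The out-neighbours of node `j`. -/
noncomputable def outNbrs (G : Digraph (Fin n)) (j : Fin n) : Finset (Fin n) :=
  Finset.univ.filter fun l => G.Adj j l

open Classical in
/-- The in-neighbours of node `j`. -/
noncomputable def inNbrs (G : Digraph (Fin n)) (j : Fin n) : Finset (Fin n) :=
  Finset.univ.filter fun i => G.Adj i j

/-- There are no self-edges. -/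
def NoSelfEdges (G : Digraph (Fin n)) : Prop :=
  ∀ v, ¬ G.Adj v v

/-- There is a directed path from every node to every other node. -/
def StronglyConnected (G : Digraph (Fin n)) : Prop :=
  ∀ u v, u ≠ v → Relation.TransGen G.Adj u v

/-- The union of the digraphs `G a, …, G (b - 1)`. -/
def unionGraph (G : ℕ → Digraph (Fin n)) (a b : ℕ) : Digraph (Fin n) :=
  ⨆ k ∈ Set.Ico a b, G k

/-- The digraphs are jointly connected over windows of bounded length: time splits into
consecutive windows `[t m, t (m + 1))`, starting at time `0` and of length less than some `l`,
and over every window the union graph is the strongly connected nominal digraph `Gnom`. -/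
def JointlyNominal (G : ℕ → Digraph (Fin n)) (Gnom : Digraph (Fin n)) : Prop :=
  StronglyConnected Gnom ∧
    ∃ (l : ℕ) (t : ℕ → ℕ), t 0 = 0 ∧
      ∀ m, t m < t (m + 1) ∧ t (m + 1) < t m + l ∧ unionGraph G (t m) (t (m + 1)) = Gnom

open Classical in
/-- The transmission probability `b_{lj}` of node `j` towards node `l`. It depends only on the
out-neighbours of `j` in the current digraph, which `j` knows. -/
noncomputable def transProb (G : Digraph (Fin n)) (l j : Fin n) : ℝ :=
  if l = j ∨ l ∈ outNbrs G j then 1 / (1 + ((outNbrs G j).card : ℝ)) else 0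

/-! ### One step of a node: splitting its mass into pieces -/

/-- The variables of a node inside its splitting loop. -/
structure Loop (n : ℕ) where
  /-- the part of the `y`-mass that is still to be assigned -/
  masY : ℤ
  /-- the number of pieces that are still to be assigned -/
  masZ : ℕ
  /-- the number of pieces that still have to be larger by one -/
  masRem : ℤ
  /-- the transmission variables `c^y` towards each node -/
  cY : Fin n → ℤ
  /-- the transmission variables `c^z` towards each node -/
  cZ : Fin n → ℕ

/-- The variables before the loop is entered, where `δ` is the size of a small piece. -/
def Loop.init (y : ℤ) (z : ℕ) (δ : ℤ) : Loop n where
  masY := y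
  masZ := z
  masRem := y - δ * z
  cY := fun _ => 0
  cZ := fun _ => 0

/-- One pass through the loop, in which the node `l` has been drawn: a piece goes to `l`, of
size `δ + 1` while there is a remainder, and of size `δ` afterwards. -/
def Loop.pass (δ : ℤ) (l : Fin n) (s : Loop n) : Loop n where
  masY := if 0 < s.masRem then s.masY - δ - 1 else s.masY - δ
  masZ := s.masZ - 1
  masRem := if 0 < s.masRem then s.masRem - 1 else s.masRem
  cY := Function.update s.cY l (if 0 < s.masRem then s.cY l + δ + 1 else s.cY l + δ)
  cZ := Function.update s.cZ l (s.cZ l + 1)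

/-- The variables after `i` passes, where `draw 0, draw 1, …` are the nodes drawn. -/
def Loop.after (y : ℤ) (z : ℕ) (δ : ℤ) (draw : ℕ → Fin n) : ℕ → Loop n
  | 0 => Loop.init y z δ
  | i + 1 => (Loop.after y z δ draw i).pass δ (draw i)

/-- Hence the loop `while masZ > 1` stops after exactly `z - 1` passes. -/
theorem Loop.after_masZ (y : ℤ) (z : ℕ) (δ : ℤ) (draw : ℕ → Fin n) (i : ℕ) :
    (Loop.after y z δ draw i).masZ = z - i := by
  induction i with
  | zero => rfl
  | succ i ih => simp only [Loop.after, Loop.pass, ih]; omega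

/-- The transmission variables `(c^y_{lj}, c^z_{lj})`, as functions of `l`, of a node `j` with
mass variables `y` and `z`. If `z > 1`, the mass is split, the first `z - 1` pieces go to the
drawn nodes, and the last one stays at `j`. Otherwise the whole mass stays at `j`. -/
def transmission (j : Fin n) (y : ℤ) (z : ℕ) (draw : ℕ → Fin n) :
    (Fin n → ℤ) × (Fin n → ℕ) :=
  if 1 < z then
    let s : Loop n := Loop.after y z ⌊(y : ℚ) / (z : ℚ)⌋ draw (z - 1)
    (Function.update s.cY j (s.cY j + s.masY), Function.update s.cZ j (s.cZ j + s.masZ))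
  else
    (Function.update (fun _ => 0) j y, Function.update (fun _ => 0) j z)

/-! ### The execution of the algorithm

`d k j i` is the node that node `j` draws in pass `i` of its loop at time step `k`. -/

/-- The mass variables of all nodes. -/
structure Mass (n : ℕ) where
  /-- the `y`-mass of each node -/
  y : Fin n → ℤ
  /-- the `z`-mass of each node -/
  z : Fin n → ℕ

/-- All nodes split their masses and transmit over the edges of the digraph `G`; then every node
adds up what it kept and what it receives. A message is sent only if its `c^z` is positive. -/
noncomputable def nextMass (G : Digraph (Fin n)) (m : Mass n) (draw : Fin n → ℕ → Fin n) :
    Mass n where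
  y j := (transmission j (m.y j) (m.z j) (draw j)).1 j +
    ∑ i ∈ inNbrs G j,
      if 0 < (transmission i (m.y i) (m.z i) (draw i)).2 j
      then (transmission i (m.y i) (m.z i) (draw i)).1 j else 0
  z j := (transmission j (m.y j) (m.z j) (draw j)).2 j +
    ∑ i ∈ inNbrs G j,
      if 0 < (transmission i (m.y i) (m.z i) (draw i)).2 j
      then (transmission i (m.y i) (m.z i) (draw i)).2 j else 0

/-- The mass variables at each time step; the initialization doubles the initial states. -/
noncomputable def mass (G : ℕ → Digraph (Fin n)) (y₀ : Fin n → ℤ) (d : ℕ → Fin n → ℕ → Fin n) :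
    ℕ → Mass n
  | 0 => { y := fun j => 2 * y₀ j, z := fun _ => 2 }
  | k + 1 => nextMass (G k) (mass G y₀ d k) (d k)

/-- The state variables `(y^s_j[k], z^s_j[k])`: they are set to the mass variables whenever
`z_j[k] > 1` (in particular at `k = 0`, where `z_j[0] = 2`) and keep their values otherwise. -/
noncomputable def stored (G : ℕ → Digraph (Fin n)) (y₀ : Fin n → ℤ)
    (d : ℕ → Fin n → ℕ → Fin n) : ℕ → Fin n → ℤ × ℕ
  | 0, j => ((mass G y₀ d 0).y j, (mass G y₀ d 0).z j)
  | k + 1, j =>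
    if 1 < (mass G y₀ d (k + 1)).z j then
      ((mass G y₀ d (k + 1)).y j, (mass G y₀ d (k + 1)).z j)
    else stored G y₀ d k j

/-- The state variable `q^s_j[k]`. -/
noncomputable def qState (G : ℕ → Digraph (Fin n)) (y₀ : Fin n → ℤ)
    (d : ℕ → Fin n → ℕ → Fin n) (k : ℕ) (j : Fin n) : ℤ :=
  ⌊((stored G y₀ d k j).1 : ℚ) / ((stored G y₀ d k j).2 : ℚ)⌋

/-- The random draws `ξ k j i` (of node `j`, in pass `i` of its loop at time step `k`) are
independent, and `ξ k j i` follows the transmission probabilities of node `j` at time `k`. -/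
structure IsDraws (G : ℕ → Digraph (Fin n)) {Ω : Type*} [MeasurableSpace Ω] (P : Measure Ω)
    (ξ : ℕ → Fin n → ℕ → Ω → Fin n) : Prop where
  measurable : ∀ k j i, Measurable (ξ k j i)
  law : ∀ k j i l, P.real {ω | ξ k j i ω = l} = transProb (G k) l j
  indep : iIndepFun (fun a : ℕ × Fin n × ℕ => ξ a.1 a.2.1 a.2.2) P

/-! ### The quantities in the conclusion -/

/-- The real average `q` of the initial states. -/
noncomputable def average (y₀ : Fin n → ℤ) : ℝ :=
  (∑ j, (y₀ j : ℝ)) / n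

/-- The total initial state error `y^init`. -/
noncomputable def initError (y₀ : Fin n → ℤ) : ℤ :=
  (∑ j with y₀ j > ⌈average y₀⌉, (y₀ j - ⌈average y₀⌉)) +
    ∑ j with y₀ j < ⌊average y₀⌋, (⌊average y₀⌋ - y₀ j)

end QuantAvg

namespace QuantAvg

variable {n : ℕ}

/-! ### Explicit form of one step -/

/-! Since `y^init + n` is a positive integer, the claimed bound is a number below 1. Hence it
suffices that the states settle by a deterministic time with probability as close to 1 as desired
(`exists_time_of_lt_one`).

After the doubling there are `2n` pieces: each node keeps one, and the other `n` walk. The state of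
a node is always the size of the piece it keeps (`qState_eq_quo`). Let `q_j` be the kept sizes and
`S` the total size of the walking pieces. If all walkers move together, the potential `n ∑ (q_j² +
q_j) + S²` never increases, and it drops whenever a kept size changes (`Gathered.drive`). If a tour
through all nodes leaves it unchanged, then `n q_v ≤ S ≤ n q_v + n` at every node `v`, which forces
a settled mass (`Gathered.settled`). Settled masses keep their states forever (`Settled.next`), and
conservation of mass makes these states `⌊q⌋` or `⌈q⌉` (`Settled.quo_eq_floor_or_ceil`).

Joint connectivity provides a deterministic tour. As the potential is bounded over reachable
gathered masses, following the tour for some fixed time `T` settles every reachable mass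
(`IsTour.exists_settled`). The draws of a time block of length `T` follow the tour with probability
at least some `p > 0`, independently over blocks, so `N` blocks all fail with probability at most
`(1 - p)^N`. -/

/-- The size of a small piece of node `j`. -/
def quo (m : Mass n) (j : Fin n) : ℤ := m.y j / m.z j

/-- The size of the piece that node `j` assigns in pass `i`. -/
def piece (m : Mass n) (j : Fin n) (i : ℕ) : ℤ :=
  quo m j + if (i : ℤ) < m.y j % m.z j then 1 else 0

/-- Every node draws itself or one of its out-neighbours. -/
def Feasible (G : Digraph (Fin n)) (draw : Fin n → ℕ → Fin n) : Prop :=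
  ∀ j i, draw j i = j ∨ G.Adj j (draw j i)

theorem Loop.after_masRem (y : ℤ) (z : ℕ) (δ : ℤ) (draw : ℕ → Fin n) (h : 0 ≤ y - δ * z) (t : ℕ) :
    (Loop.after y z δ draw t).masRem = max (y - δ * z - t) 0 := by
  induction t with
  | zero => simpa [Loop.after, Loop.init] using h
  | succ t ih => simp only [Loop.after, Loop.pass, ih]; push_cast; split_ifs <;> omega

theorem Loop.after_masY (y : ℤ) (z : ℕ) (δ : ℤ) (draw : ℕ → Fin n) (h : 0 ≤ y - δ * z) (t : ℕ) :
    (Loop.after y z δ draw t).masY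
      = y - ∑ i ∈ Finset.range t, (δ + if (i : ℤ) < y - δ * z then 1 else 0) := by
  induction t with
  | zero => simp [Loop.after, Loop.init]
  | succ t ih =>
    simp only [Loop.after, Loop.pass, ih, Loop.after_masRem y z δ draw h, Finset.sum_range_succ]
    split_ifs <;> omega

theorem Loop.after_cY (y : ℤ) (z : ℕ) (δ : ℤ) (draw : ℕ → Fin n) (h : 0 ≤ y - δ * z) (t : ℕ)
    (l : Fin n) :
    (Loop.after y z δ draw t).cY l
      = ∑ i ∈ Finset.range t,
        if draw i = l then δ + (if (i : ℤ) < y - δ * z then 1 else 0) else 0 := by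
  induction t with
  | zero => simp [Loop.after, Loop.init]
  | succ t ih =>
    simp only [Loop.after, Loop.pass, Loop.after_masRem y z δ draw h, Finset.sum_range_succ,
      Function.update_apply, ← ih]
    by_cases hl : l = draw t
    · subst hl
      simp only [if_true]
      split_ifs <;> omega
    · rw [if_neg hl, if_neg (Ne.symm hl), add_zero]

theorem Loop.after_cZ (y : ℤ) (z : ℕ) (δ : ℤ) (draw : ℕ → Fin n) (t : ℕ) (l : Fin n) :
    (Loop.after y z δ draw t).cZ l = ∑ i ∈ Finset.range t, if draw i = l then 1 else 0 := by
  induction t with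
  | zero => simp [Loop.after, Loop.init]
  | succ t ih =>
    simp only [Loop.after, Loop.pass, Finset.sum_range_succ, Function.update_apply, ← ih]
    by_cases hl : l = draw t
    · subst hl; simp
    · rw [if_neg hl, if_neg (Ne.symm hl), add_zero]

theorem sum_range_lt (δ : ℤ) (t : ℕ) (r : ℤ) (h0 : 0 ≤ r) :
    ∑ i ∈ Finset.range t, (δ + if (i : ℤ) < r then 1 else 0) = t * δ + min r t := by
  induction t with
  | zero => simp [h0]
  | succ t ih =>
    rw [Finset.sum_range_succ, ih]
    push_cast
    rw [add_mul, one_mul]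
    split_ifs <;> omega

theorem sum_piece (m : Mass n) (j : Fin n) (hz : 1 ≤ m.z j) :
    ∑ i ∈ Finset.range (m.z j - 1), piece m j i = m.y j - quo m j := by
  have hz' : (0 : ℤ) < m.z j := by exact_mod_cast hz
  have h0 := Int.emod_nonneg (m.y j) hz'.ne'
  have h1 := Int.emod_lt_of_pos (m.y j) hz'
  have h2 := Int.mul_ediv_add_emod (m.y j) (m.z j)
  simp only [piece]
  rw [sum_range_lt _ _ _ h0, Nat.cast_sub hz, min_eq_left (by push_cast; omega)]
  simp only [quo]
  push_cast
  linarith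

theorem transmission_eq (m : Mass n) (j : Fin n) (draw : ℕ → Fin n) (hz : 1 ≤ m.z j) :
    transmission j (m.y j) (m.z j) draw =
      (fun l => (∑ i ∈ Finset.range (m.z j - 1), if draw i = l then piece m j i else 0)
          + if l = j then quo m j else 0,
        fun l => (∑ i ∈ Finset.range (m.z j - 1), if draw i = l then 1 else 0)
          + if l = j then 1 else 0) := by
  have hz' : (0 : ℤ) < m.z j := by exact_mod_cast hz
  have hr : m.y j - quo m j * m.z j = m.y j % m.z j := by
    have h2 := Int.mul_ediv_add_emod (m.y j) (m.z j)
    simp only [quo]; linarith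
  have h0 : 0 ≤ m.y j - quo m j * m.z j := hr ▸ Int.emod_nonneg (m.y j) hz'.ne'
  by_cases h : 1 < m.z j
  · have hq : ⌊(m.y j : ℚ) / (m.z j : ℚ)⌋ = quo m j := Rat.floor_intCast_div_natCast _ _
    have hY := sum_piece m j hz
    simp only [piece, ← hr] at hY
    simp only [transmission, if_pos h, hq, Loop.after_masZ]
    refine Prod.ext (funext fun l => ?_) (funext fun l => ?_)
    · by_cases hl : l = j
      · subst hl
        simp only [Function.update_self, Loop.after_cY _ _ _ _ h0, Loop.after_masY _ _ _ _ h0, hY,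
          piece, ← hr, if_true]
        ring
      · simp only [Function.update_of_ne hl, Loop.after_cY _ _ _ _ h0, piece, ← hr, if_neg hl,
          add_zero]
    · by_cases hl : l = j
      · subst hl
        simp only [Function.update_self, Loop.after_cZ, if_true]
        omega
      · simp only [Function.update_of_ne hl, Loop.after_cZ, if_neg hl, add_zero]
  · have h1 : m.z j = 1 := by omega
    simp only [transmission, h1]
    refine Prod.ext (funext fun l => ?_) (funext fun l => ?_) <;> by_cases hl : l = j <;>
      simp [hl, quo, h1]

theorem add_sum_inNbrs {M : Type*} [AddCommMonoid M] {G : Digraph (Fin n)} (hG : NoSelfEdges G)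
    (l : Fin n) (f : Fin n → M) (hf : ∀ j, j ≠ l → ¬ G.Adj j l → f j = 0) :
    f l + ∑ j ∈ inNbrs G l, f j = ∑ j, f j := by
  classical
  have hl : l ∉ inNbrs G l := by simp [inNbrs, hG l]
  rw [← Finset.sum_insert hl]
  refine Finset.sum_subset (Finset.subset_univ _) fun j _ hj => ?_
  rw [Finset.mem_insert, not_or] at hj
  exact hf j hj.1 (by simpa [inNbrs] using hj.2)

theorem Feasible.ne {G : Digraph (Fin n)} {draw : Fin n → ℕ → Fin n} (hd : Feasible G draw)
    {j l : Fin n} (hj : j ≠ l) (hjl : ¬ G.Adj j l) (i : ℕ) : draw j i ≠ l := by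
  intro hi
  rcases hd j i with h | h
  · exact hj (h.symm.trans hi)
  · exact hjl (hi ▸ h)

theorem ne_of_mem_inNbrs {G : Digraph (Fin n)} (hG : NoSelfEdges G) {j l : Fin n}
    (hj : j ∈ inNbrs G l) : l ≠ j := by
  rintro rfl
  exact hG l (by simpa [inNbrs] using hj)

theorem nextMass_z {G : Digraph (Fin n)} (hG : NoSelfEdges G) {m : Mass n}
    (hz : ∀ j, 1 ≤ m.z j) {draw : Fin n → ℕ → Fin n} (hd : Feasible G draw) (l : Fin n) :
    (nextMass G m draw).z l =
      1 + ∑ j, ∑ i ∈ Finset.range (m.z j - 1), if draw j i = l then 1 else 0 := by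
  simp only [nextMass, transmission_eq m _ _ (hz _)]
  rw [← add_sum_inNbrs hG l _ fun j h1 h2 => Finset.sum_eq_zero fun i _ => if_neg (hd.ne h1 h2 i),
    if_pos trivial, add_comm _ 1, add_assoc]
  congr 2
  refine Finset.sum_congr rfl fun j hj => ?_
  rw [if_neg (ne_of_mem_inNbrs hG hj), add_zero]
  exact ite_eq_left_iff.2 fun h => by omega

theorem nextMass_y {G : Digraph (Fin n)} (hG : NoSelfEdges G) {m : Mass n}
    (hz : ∀ j, 1 ≤ m.z j) {draw : Fin n → ℕ → Fin n} (hd : Feasible G draw) (l : Fin n) :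
    (nextMass G m draw).y l =
      quo m l + ∑ j, ∑ i ∈ Finset.range (m.z j - 1), if draw j i = l then piece m j i else 0 := by
  simp only [nextMass, transmission_eq m _ _ (hz _)]
  rw [← add_sum_inNbrs hG l _ fun j h1 h2 => Finset.sum_eq_zero fun i _ => if_neg (hd.ne h1 h2 i),
    if_pos trivial, add_comm _ (quo m l), add_assoc]
  congr 2
  refine Finset.sum_congr rfl fun j hj => ?_
  rw [if_neg (ne_of_mem_inNbrs hG hj), if_neg (ne_of_mem_inNbrs hG hj), add_zero, add_zero]
  -- A message is suppressed only if it contains no piece, and then its `y`-part is an empty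
  -- contribution as well.
  refine ite_eq_left_iff.2 fun h => (Finset.sum_eq_zero fun i hi => if_neg fun hi' => h ?_).symm
  exact Finset.sum_pos' (fun _ _ => Nat.zero_le _) ⟨i, hi, by simp [hi']⟩

/-! ### Invariants of one step -/

/-- A piece of size `p` contributes `p - c`, so a common bound on the pieces becomes a sign of `y -
c z` at every node. -/
theorem nextMass_sub {G : Digraph (Fin n)} (hG : NoSelfEdges G) {m : Mass n}
    (hz : ∀ j, 1 ≤ m.z j) {draw : Fin n → ℕ → Fin n} (hd : Feasible G draw) (c : ℤ) (l : Fin n) :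
    (nextMass G m draw).y l - c * (nextMass G m draw).z l = (quo m l - c) +
      ∑ j, ∑ i ∈ Finset.range (m.z j - 1), if draw j i = l then piece m j i - c else 0 := by
  have h : ∀ j i, (if draw j i = l then piece m j i - c else 0)
      = (if draw j i = l then piece m j i else 0) - c * (if draw j i = l then 1 else 0) := by
    intro j i; split_ifs <;> ring
  rw [nextMass_y hG hz hd, nextMass_z hG hz hd]
  simp only [h, Finset.sum_sub_distrib, ← Finset.mul_sum]
  push_cast
  ring

theorem one_le_nextMass_z {G : Digraph (Fin n)} (hG : NoSelfEdges G) {m : Mass n}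
    (hz : ∀ j, 1 ≤ m.z j) {draw : Fin n → ℕ → Fin n} (hd : Feasible G draw) (l : Fin n) :
    1 ≤ (nextMass G m draw).z l := by
  rw [nextMass_z hG hz hd]; omega

theorem sum_sum_draw {M : Type*} [AddCommMonoid M] (draw : Fin n → ℕ → Fin n) (t : Fin n → ℕ)
    (f : Fin n → ℕ → M) :
    ∑ l, ∑ j, ∑ i ∈ Finset.range (t j), (if draw j i = l then f j i else 0)
      = ∑ j, ∑ i ∈ Finset.range (t j), f j i := by
  rw [Finset.sum_comm]
  refine Finset.sum_congr rfl fun j _ => ?_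
  rw [Finset.sum_comm]
  exact Finset.sum_congr rfl fun i _ => by simp

theorem sum_nextMass_z {G : Digraph (Fin n)} (hG : NoSelfEdges G) {m : Mass n}
    (hz : ∀ j, 1 ≤ m.z j) {draw : Fin n → ℕ → Fin n} (hd : Feasible G draw) :
    ∑ l, (nextMass G m draw).z l = ∑ l, m.z l := by
  simp only [nextMass_z hG hz hd, Finset.sum_add_distrib (f := fun _ => 1)]
  rw [sum_sum_draw draw (fun j => m.z j - 1) fun _ _ => 1, ← Finset.sum_add_distrib]
  refine Finset.sum_congr rfl fun j _ => ?_
  have := hz j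
  simp only [Finset.sum_const, Finset.card_range, smul_eq_mul]
  omega

theorem sum_nextMass_y {G : Digraph (Fin n)} (hG : NoSelfEdges G) {m : Mass n}
    (hz : ∀ j, 1 ≤ m.z j) {draw : Fin n → ℕ → Fin n} (hd : Feasible G draw) :
    ∑ l, (nextMass G m draw).y l = ∑ l, m.y l := by
  simp only [nextMass_y hG hz hd, Finset.sum_add_distrib (f := quo m)]
  rw [sum_sum_draw draw (fun j => m.z j - 1) (piece m), ← Finset.sum_add_distrib]
  refine Finset.sum_congr rfl fun j _ => ?_
  rw [sum_piece m j (hz j)]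
  ring

theorem quo_mul_add (m : Mass n) (j : Fin n) : quo m j * m.z j + m.y j % m.z j = m.y j := by
  rw [quo, mul_comm]; exact Int.mul_ediv_add_emod _ _

theorem quo_eq_iff {m : Mass n} {j : Fin n} (hz : 1 ≤ m.z j) (c : ℤ) :
    quo m j = c ↔ 0 ≤ m.y j - c * m.z j ∧ m.y j - (c + 1) * m.z j < 0 := by
  have hz' : (0 : ℤ) < m.z j := by exact_mod_cast hz
  rw [quo, Int.ediv_eq_iff_of_pos hz']
  constructor <;> rintro ⟨h1, h2⟩ <;> constructor <;> nlinarith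

theorem le_quo {m : Mass n} {j : Fin n} (hz : 1 ≤ m.z j) {c : ℤ} (h : c * m.z j ≤ m.y j) :
    c ≤ quo m j := by
  have hz' : (0 : ℤ) < m.z j := by exact_mod_cast hz
  exact (Int.le_ediv_iff_mul_le hz').2 h

theorem quo_le_piece (m : Mass n) (j : Fin n) (i : ℕ) : quo m j ≤ piece m j i := by
  rw [piece]; split_ifs <;> omega

theorem piece_le_quo (m : Mass n) (j : Fin n) (i : ℕ) : piece m j i ≤ quo m j + 1 := by
  rw [piece]; split_ifs <;> omega

theorem piece_le {m : Mass n} {j : Fin n} (hz : 1 ≤ m.z j) {c : ℤ} (h : m.y j ≤ c * m.z j)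
    (i : ℕ) : piece m j i ≤ c := by
  have hz' : (0 : ℤ) < m.z j := by exact_mod_cast hz
  have h0 := quo_mul_add m j
  have h1 := Int.emod_nonneg (m.y j) hz'.ne'
  rw [piece]
  split_ifs with hi
  · refine Int.add_one_le_of_lt (lt_of_mul_lt_mul_right (a := (m.z j : ℤ)) ?_ hz'.le)
    omega
  · rw [add_zero]
    refine le_of_mul_le_mul_right (a := (m.z j : ℤ)) ?_ hz'
    omega

/-- The invariants of all executions that start with the initial states `y₀`, for a bound `B` on
the initial states. -/
structure Reachable (y₀ : Fin n → ℤ) (B : ℤ) (m : Mass n) : Prop where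
  pos : ∀ j, 1 ≤ m.z j
  sum_z : ∑ j, m.z j = 2 * n
  sum_y : ∑ j, m.y j = 2 * ∑ j, y₀ j
  le_y : ∀ j, -B * m.z j ≤ m.y j
  y_le : ∀ j, m.y j ≤ B * m.z j

theorem Reachable.next {y₀ : Fin n → ℤ} {B : ℤ} {m : Mass n} (h : Reachable y₀ B m)
    {G : Digraph (Fin n)} (hG : NoSelfEdges G) {draw : Fin n → ℕ → Fin n} (hd : Feasible G draw) :
    Reachable y₀ B (nextMass G m draw) where
  pos := one_le_nextMass_z hG h.pos hd
  sum_z := (sum_nextMass_z hG h.pos hd).trans h.sum_z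
  sum_y := (sum_nextMass_y hG h.pos hd).trans h.sum_y
  le_y l := by
    have hq : ∀ j, -B ≤ quo m j := fun j => le_quo (h.pos j) (h.le_y j)
    have := nextMass_sub hG h.pos hd (-B) l
    have h2 : 0 ≤ ∑ j, ∑ i ∈ Finset.range (m.z j - 1),
        if draw j i = l then piece m j i - -B else 0 := by
      refine Finset.sum_nonneg fun j _ => Finset.sum_nonneg fun i _ => ?_
      have := hq j
      have := quo_le_piece m j i
      split_ifs <;> omega
    have := hq l
    linarith
  y_le l := by
    have := nextMass_sub hG h.pos hd B l
    have h2 : ∑ j, ∑ i ∈ Finset.range (m.z j - 1),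
        (if draw j i = l then piece m j i - B else 0) ≤ 0 := by
      refine Finset.sum_nonpos fun j _ => Finset.sum_nonpos fun i _ => ?_
      have := piece_le (h.pos j) (h.y_le j) i
      split_ifs <;> omega
    have := piece_le (h.pos l) (h.y_le l) 0
    have := quo_le_piece m l 0
    linarith

theorem reachable_mass {G : ℕ → Digraph (Fin n)} (hG : ∀ k, NoSelfEdges (G k)) {y₀ : Fin n → ℤ}
    {B : ℤ} (hB : ∀ j, |y₀ j| ≤ B) {d : ℕ → Fin n → ℕ → Fin n} (hd : ∀ k, Feasible (G k) (d k))
    (k : ℕ) : Reachable y₀ B (mass G y₀ d k) := by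
  induction k with
  | zero =>
    refine ⟨fun j => ?_, ?_, ?_, fun j => ?_, fun j => ?_⟩
    · simp [mass]
    · simp [mass, mul_comm]
    · simp [mass, Finset.mul_sum]
    · have := (abs_le.1 (hB j)).1
      simp only [mass]; push_cast; linarith
    · have := (abs_le.1 (hB j)).2
      simp only [mass]; push_cast; linarith
  | succ k ih => exact ih.next (hG k) (hd k)

/-! ### The states of the nodes -/

/-- If `z = 1` after a step, no piece was sent to the node, so its mass is just the piece it kept.
That piece is the previous quotient, in agreement with the frozen state. -/
theorem qState_eq_quo {G : ℕ → Digraph (Fin n)} (hG : ∀ k, NoSelfEdges (G k)) {y₀ : Fin n → ℤ}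
    {d : ℕ → Fin n → ℕ → Fin n} (hd : ∀ k, Feasible (G k) (d k))
    (hz : ∀ k j, 1 ≤ (mass G y₀ d k).z j) (k : ℕ) (j : Fin n) :
    qState G y₀ d k j = quo (mass G y₀ d k) j := by
  induction k with
  | zero =>
    simp only [qState, stored]
    exact Rat.floor_intCast_div_natCast _ _
  | succ k ih =>
    by_cases h : 1 < (mass G y₀ d (k + 1)).z j
    · simp only [qState, stored, if_pos h]
      exact Rat.floor_intCast_div_natCast _ _
    · have h1 : (mass G y₀ d (k + 1)).z j = 1 := le_antisymm (not_lt.1 h) (hz _ _)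
      have hs : stored G y₀ d (k + 1) j = stored G y₀ d k j := by simp only [stored, if_neg h]
      rw [qState, hs, ← qState, ih, quo.eq_def (mass G y₀ d (k + 1)), h1, Nat.cast_one,
        Int.ediv_one, mass, nextMass_y (hG k) (hz k) (hd k)]
      have h2 : ∑ j', ∑ i ∈ Finset.range ((mass G y₀ d k).z j' - 1),
          (if d k j' i = j then 1 else 0) = 0 := by
        have h3 := nextMass_z (hG k) (hz k) (hd k) j
        rw [mass] at h1
        omega
      rw [Finset.sum_eq_zero, add_zero]
      intro j' _
      refine Finset.sum_eq_zero fun i hi => if_neg fun hi' => ?_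
      have := Finset.sum_eq_zero_iff.1 (Finset.sum_eq_zero_iff.1 h2 j' (Finset.mem_univ _)) i hi
      simp [hi'] at this

/-! ### Settled masses -/

/-- Either every node keeps a piece of size `F`, or all pieces other than those kept have size
`F + 1`, and those kept have size `F` or `F + 1`. -/
def Settled (F : ℤ) (m : Mass n) : Prop :=
  (∀ j, quo m j = F) ∨
    ∀ j, (quo m j = F ∨ quo m j = F + 1) ∧ m.y j - (F + 1) * m.z j = quo m j - (F + 1)

/-- In the first case all pieces are `F` or `F + 1` and each node keeps an `F`, so `F z ≤ y < (F +
1) z` wherever the others go. In the second case only pieces of size `F + 1` move, and their number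
beside the kept piece does not affect the floor. -/
theorem Settled.next {F : ℤ} {m : Mass n} (h : Settled F m) {G : Digraph (Fin n)}
    (hG : NoSelfEdges G) (hz : ∀ j, 1 ≤ m.z j) {draw : Fin n → ℕ → Fin n} (hd : Feasible G draw) :
    Settled F (nextMass G m draw) ∧ ∀ j, quo (nextMass G m draw) j = quo m j := by
  have hz' := one_le_nextMass_z hG hz hd
  rcases h with h | h
  · have key : ∀ l, quo (nextMass G m draw) l = F := by
      intro l
      rw [quo_eq_iff (hz' l), nextMass_sub hG hz hd, nextMass_sub hG hz hd, h l]
      constructor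
      · have : 0 ≤ ∑ j, ∑ i ∈ Finset.range (m.z j - 1),
            if draw j i = l then piece m j i - F else 0 := by
          refine Finset.sum_nonneg fun j _ => Finset.sum_nonneg fun i _ => ?_
          have := h j
          have := quo_le_piece m j i
          split_ifs <;> omega
        linarith
      · have : ∑ j, ∑ i ∈ Finset.range (m.z j - 1),
            (if draw j i = l then piece m j i - (F + 1) else 0) ≤ 0 := by
          refine Finset.sum_nonpos fun j _ => Finset.sum_nonpos fun i _ => ?_
          have := h j
          have := piece_le_quo m j i
          split_ifs <;> omega
        linarith
    exact ⟨Or.inl key, fun l => (key l).trans (h l).symm⟩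
  · have hp : ∀ j, ∀ i ∈ Finset.range (m.z j - 1), piece m j i = F + 1 := by
      intro j i hi
      have h0 := quo_mul_add m j
      have hi' : (i : ℤ) < m.z j - 1 := by
        have := Finset.mem_range.1 hi
        omega
      obtain ⟨h1 | h1, h2⟩ := h j
      -- Remainder `z - 1` makes every piece but the kept one large; remainder `0` below makes all
      -- pieces equal.
      · have : m.y j % m.z j = m.z j - 1 := by rw [h1] at h0 h2; linarith
        rw [piece, if_pos (by omega), h1]
      · have : m.y j % m.z j = 0 := by rw [h1] at h0 h2; linarith
        rw [piece, if_neg (by omega), h1, add_zero]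
    have hy : ∀ l, (nextMass G m draw).y l - (F + 1) * (nextMass G m draw).z l
        = quo m l - (F + 1) := by
      intro l
      rw [nextMass_sub hG hz hd, Finset.sum_eq_zero fun j _ => Finset.sum_eq_zero fun i hi => ?_,
        add_zero]
      rw [hp j i hi, sub_self, ite_self]
    have key : ∀ l, quo (nextMass G m draw) l = quo m l := by
      intro l
      have h1 : (1 : ℤ) ≤ (nextMass G m draw).z l := by exact_mod_cast hz' l
      have h2 := hy l
      rw [quo_eq_iff (hz' l)]
      rcases (h l).1 with h3 | h3 <;> rw [h3] at h2 ⊢ <;> constructor <;> linarith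
    exact ⟨Or.inr fun l => ⟨by rw [key]; exact (h l).1, by rw [key, hy]⟩, key⟩

theorem Settled.quo_eq_floor_or_ceil (hn : 0 < n) {F : ℤ} {m : Mass n} (h : Settled F m)
    {y₀ : Fin n → ℤ} {B : ℤ} (hm : Reachable y₀ B m) (j : Fin n) :
    quo m j = ⌊average y₀⌋ ∨ quo m j = ⌈average y₀⌉ := by
  have hn' : (0 : ℝ) < n := by exact_mod_cast hn
  have hs : ∀ c : ℤ, ∑ l, (m.y l - c * m.z l) = 2 * (∑ l, y₀ l - c * n) := by
    intro c
    have := hm.sum_z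
    rw [Finset.sum_sub_distrib, hm.sum_y, ← Finset.mul_sum, ← Nat.cast_sum, this]
    push_cast; ring
  have hle : ∀ c : ℤ, 0 ≤ ∑ l, y₀ l - c * n → (c : ℝ) ≤ average y₀ := by
    intro c hc
    rw [average, le_div_iff₀ hn']
    exact_mod_cast sub_nonneg.1 hc
  have hlt : ∀ c : ℤ, ∑ l, y₀ l - c * n < 0 → average y₀ < c := by
    intro c hc
    rw [average, div_lt_iff₀ hn']
    exact_mod_cast sub_neg.1 hc
  have hne : (Finset.univ : Finset (Fin n)).Nonempty := ⟨j, Finset.mem_univ _⟩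
  rcases h with h | h
  · left
    rw [h, eq_comm, Int.floor_eq_iff]
    constructor
    · refine hle F ?_
      have : 0 ≤ ∑ l, (m.y l - F * m.z l) :=
        Finset.sum_nonneg fun l _ => ((quo_eq_iff (hm.pos l) F).1 (h l)).1
      rw [hs] at this; linarith
    · have : ∑ l, (m.y l - (F + 1) * m.z l) < 0 :=
        Finset.sum_neg (fun l _ => ((quo_eq_iff (hm.pos l) F).1 (h l)).2) hne
      rw [hs] at this
      exact_mod_cast hlt (F + 1) (by linarith)
  · have h1 : ∑ l, (m.y l - (F + 1) * m.z l) = ∑ l, (quo m l - (F + 1)) :=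
      Finset.sum_congr rfl fun l _ => (h l).2
    rw [hs] at h1
    by_cases hall : ∀ l, quo m l = F + 1
    · left
      have h2 : ∑ l, (quo m l - (F + 1)) = 0 :=
        Finset.sum_eq_zero fun l _ => by rw [hall l, sub_self]
      have h3 : average y₀ = ((F + 1 : ℤ) : ℝ) := by
        rw [average, div_eq_iff hn'.ne']
        have : ∑ l, y₀ l = (F + 1) * n := by linarith
        exact_mod_cast this
      rw [hall, h3, Int.floor_intCast]
    · push Not at hall
      obtain ⟨l₀, hl₀⟩ := hall
      have h2 : ∑ l, (quo m l - (F + 1)) < 0 := by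
        refine Finset.sum_neg' (fun l _ => ?_) ⟨l₀, Finset.mem_univ _, ?_⟩
        · rcases (h l).1 with h | h <;> omega
        · rcases (h l₀).1 with h | h <;> omega
      -- By `h1` this sum is `2 (∑ y₀ - (F + 1) n)`. Being at least `-n`, it puts the average at `F
      -- + 1/2` or above, hence strictly above `F`.
      have h3 : -(n : ℤ) ≤ ∑ l, (quo m l - (F + 1)) := by
        have : ∑ _l : Fin n, (-1 : ℤ) ≤ ∑ l, (quo m l - (F + 1)) :=
          Finset.sum_le_sum fun l _ => by rcases (h l).1 with h | h <;> omega
        simpa using this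
      have h4 := hlt (F + 1) (by linarith)
      have hnz : (1 : ℤ) ≤ n := by exact_mod_cast hn
      have h6 : (F : ℝ) < average y₀ := by
        rw [average, lt_div_iff₀ hn']
        have : F * n < ∑ l, y₀ l := by linarith
        exact_mod_cast this
      rcases (h j).1 with h | h
      · left
        rw [h, eq_comm, Int.floor_eq_iff]
        exact ⟨h6.le, by exact_mod_cast h4⟩
      · right
        rw [h, eq_comm, Int.ceil_eq_iff]
        exact ⟨by push_cast; linarith, h4.le⟩

theorem Settled.mass_of_le {G : ℕ → Digraph (Fin n)} (hG : ∀ k, NoSelfEdges (G k))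
    {y₀ : Fin n → ℤ} {d : ℕ → Fin n → ℕ → Fin n} (hd : ∀ k, Feasible (G k) (d k))
    (hz : ∀ k j, 1 ≤ (mass G y₀ d k).z j) {F : ℤ} {k₀ : ℕ} (h : Settled F (mass G y₀ d k₀))
    {k : ℕ} (hk : k₀ ≤ k) :
    Settled F (mass G y₀ d k) ∧ ∀ j, quo (mass G y₀ d k) j = quo (mass G y₀ d k₀) j := by
  induction k, hk using Nat.le_induction with
  | base => exact ⟨h, fun _ => rfl⟩
  | succ k _ ih =>
    obtain ⟨h1, h2⟩ := ih.1.next (hG k) (hz k) (hd k)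
    exact ⟨h1, fun j => (h2 j).trans (ih.2 j)⟩

/-! ### Draws that do not depend on the pass -/

/-- The mass variables pass from `m` to `m'` if every node `j` sends all its pieces except the one
it keeps to `h j`. -/
structure Drive (h : Fin n → Fin n) (m m' : Mass n) : Prop where
  z_eq : ∀ l, m'.z l = 1 + ∑ j, if h j = l then m.z j - 1 else 0
  y_eq : ∀ l, m'.y l = quo m l + ∑ j, if h j = l then m.y j - quo m j else 0

theorem drive_nextMass {G : Digraph (Fin n)} (hG : NoSelfEdges G) {m : Mass n}
    (hz : ∀ j, 1 ≤ m.z j) {draw : Fin n → ℕ → Fin n} (hd : Feasible G draw) {h : Fin n → Fin n}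
    (hh : ∀ j, ∀ i < m.z j - 1, draw j i = h j) : Drive h m (nextMass G m draw) where
  z_eq l := by
    rw [nextMass_z hG hz hd]
    congr 1
    refine Finset.sum_congr rfl fun j _ => ?_
    rw [Finset.sum_congr rfl fun i hi => by rw [hh j i (Finset.mem_range.1 hi)]]
    split_ifs <;> simp
  y_eq l := by
    rw [nextMass_y hG hz hd]
    congr 1
    refine Finset.sum_congr rfl fun j _ => ?_
    rw [Finset.sum_congr rfl fun i hi => by rw [hh j i (Finset.mem_range.1 hi)]]
    split_ifs
    · exact sum_piece m j (hz j)
    · simp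

/-- The position after `t` steps of a walker that starts at time `k` and follows the maps `H`. -/
def walk (H : ℕ → Fin n → Fin n) (k : ℕ) : ℕ → Fin n → Fin n
  | 0, j => j
  | t + 1, j => H (k + t) (walk H k t j)

theorem walk_add (H : ℕ → Fin n → Fin n) (k s t : ℕ) (j : Fin n) :
    walk H k (s + t) j = walk H (k + s) t (walk H k s j) := by
  induction t with
  | zero => rfl
  | succ t ih => rw [← add_assoc, walk, walk, ih, add_assoc]

/-- `z - 1` counts the walking pieces at a node. Under common maps their positions evolve by
composition, whatever their sizes. -/
theorem z_sub_one_eq_of_drive {H : ℕ → Fin n → Fin n} {x : ℕ → Mass n} {k t : ℕ}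
    (hx : ∀ s, k ≤ s → s < k + t → Drive (H s) (x s) (x (s + 1)))
    (hz : ∀ j, 1 ≤ (x k).z j) (l : Fin n) :
    (x (k + t)).z l = 1 + ∑ j, if walk H k t j = l then (x k).z j - 1 else 0 := by
  induction t generalizing l with
  | zero =>
    have := hz l
    have h0 : ∑ j, (if walk H k 0 j = l then (x k).z j - 1 else 0) = (x k).z l - 1 :=
      (Finset.sum_eq_single l (fun j _ hj => if_neg hj)
        fun h => absurd (Finset.mem_univ l) h).trans (if_pos rfl)
    rw [h0, add_zero]
    omega
  | succ t ih =>
    have ih' := ih fun s h1 h2 => hx s h1 (by omega)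
    rw [← add_assoc, (hx (k + t) (by omega) (by omega)).z_eq]
    congr 1
    simp only [ih', add_tsub_cancel_left, walk]
    rw [Finset.sum_congr rfl fun j _ => (show _ = ∑ i, if H (k + t) j = l then
      (if walk H k t i = j then (x k).z i - 1 else 0) else 0 by split_ifs <;> simp),
      Finset.sum_comm]
    refine Finset.sum_congr rfl fun i _ => ?_
    rw [Finset.sum_eq_single (walk H k t i) 
      (fun j _ hj => by rw [if_neg hj.symm, ite_self]) (by simp), if_pos rfl]
    rfl

/-! ### All walking pieces at one node -/

/-- All pieces other than those kept are at the node `c`. -/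
def Gathered (m : Mass n) (c : Fin n) : Prop := ∀ l, m.z l = 1 + if l = c then n else 0

/-- The total size of the pieces that are not kept. -/
def surplus (m : Mass n) : ℤ := ∑ j, (m.y j - quo m j)

/-- The potential of a mass whose walking pieces are gathered. -/
def potential (m : Mass n) : ℤ := n * ∑ j, (quo m j ^ 2 + quo m j) + surplus m ^ 2

theorem potential_nonneg (m : Mass n) : 0 ≤ potential m := by
  have : 0 ≤ ∑ j, (quo m j ^ 2 + quo m j) := by
    refine Finset.sum_nonneg fun j _ => ?_
    rcases le_or_gt 0 (quo m j) with h | h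
    · positivity
    · nlinarith
  unfold potential
  positivity

theorem Gathered.pos {m : Mass n} {c : Fin n} (h : Gathered m c) (j : Fin n) : 1 ≤ m.z j := by
  rw [h j]; omega

theorem Gathered.quo_eq {m : Mass n} {c : Fin n} (h : Gathered m c) {j : Fin n} (hj : j ≠ c) :
    quo m j = m.y j := by
  simp [quo, h j, hj]

theorem Gathered.surplus_eq {m : Mass n} {c : Fin n} (h : Gathered m c) :
    surplus m = m.y c - quo m c := by
  rw [surplus, Finset.sum_eq_single c (fun j _ hj => by rw [h.quo_eq hj, sub_self]) (by simp)]

/-- At `c` the mass is `quo + S` over `n + 1` pieces. The bounds are those of the floor, with the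
strict upper one sharpened by integrality. -/
theorem Gathered.surplus_bounds {m : Mass n} {c : Fin n} (h : Gathered m c) :
    n * quo m c ≤ surplus m ∧ surplus m ≤ n * quo m c + n := by
  obtain ⟨h1, h2⟩ := (quo_eq_iff (h.pos c) (quo m c)).1 rfl
  rw [h c, if_pos rfl] at h1 h2
  push_cast at h1 h2
  rw [h.surplus_eq]
  constructor <;> nlinarith

theorem Gathered.y_eq {m : Mass n} {c : Fin n} (h : Gathered m c) (j : Fin n) :
    m.y j = quo m j + if j = c then surplus m else 0 := by
  split_ifs with hj
  · rw [hj, h.surplus_eq]; ring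
  · rw [h.quo_eq hj, add_zero]

/-- The walkers exchange `d` with a kept piece that goes from `a` to `a'`. Writing `a² + a` as `(a +
1/2)² - 1/4` centres the quadratic on the interval `[N a', N a' + N]` to which rounding down
confines `S'`; this gives the loss `d²`. -/
theorem potential_change {N a a' S S' d : ℤ} (hN : 0 ≤ N) (hd : a = a' + d) (hS : S' = S + d)
    (h1 : N * a' ≤ S') (h2 : S' ≤ N * a' + N) :
    N * (a' ^ 2 + a') + S' ^ 2 ≤ N * (a ^ 2 + a) + S ^ 2 - d ^ 2 := by
  have hS' : S = S' - d := by linarith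
  subst hd hS'
  have key : N * (a' ^ 2 + a') + S' ^ 2 - (N * ((a' + d) ^ 2 + (a' + d)) + (S' - d) ^ 2)
      = d * (2 * S' - d - N * (2 * a' + d + 1)) := by ring
  rcases lt_trichotomy d 0 with h | h | h
  · have : -d ≤ 2 * S' - d - N * (2 * a' + d + 1) := by nlinarith
    nlinarith
  · subst h; simp
  · have : 2 * S' - d - N * (2 * a' + d + 1) ≤ -d := by nlinarith
    nlinarith

/-- Only the node `h c` where the walkers arrive can change its kept piece, so the potential changes
by the two terms treated in `potential_change`. -/
theorem Gathered.drive {m m' : Mass n} {c : Fin n} {h : Fin n → Fin n} (hm : Gathered m c)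
    (hd : Drive h m m') :
    Gathered m' (h c) ∧ potential m' ≤ potential m ∧
      (potential m' = potential m → quo m' = quo m ∧ surplus m' = surplus m) := by
  have hg : Gathered m' (h c) := by
    intro l
    rw [hd.z_eq, Finset.sum_eq_single c (fun j _ hj => by simp [hm j, hj]) (by simp)]
    simp [hm c, eq_comm]
  have hy : ∀ l, m'.y l = quo m l + if l = h c then surplus m else 0 := by
    intro l
    rw [hd.y_eq, Finset.sum_eq_single c (fun j _ hj => by simp [hm.quo_eq hj]) (by simp),
      hm.surplus_eq]
    simp only [eq_comm]
  have hq : ∀ l, l ≠ h c → quo m' l = quo m l := fun l hl => by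
    rw [hg.quo_eq hl, hy, if_neg hl, add_zero]
  have hS : surplus m' = surplus m + (quo m (h c) - quo m' (h c)) := by
    rw [hg.surplus_eq, hy, if_pos rfl]; ring
  have hpot : ∀ m : Mass n, potential m = n * (quo m (h c) ^ 2 + quo m (h c)) + surplus m ^ 2 +
      n * ∑ j ∈ Finset.univ.erase (h c), (quo m j ^ 2 + quo m j) := by
    intro m
    rw [potential, ← Finset.add_sum_erase _ _ (Finset.mem_univ (h c))]
    ring
  have hrest : ∑ j ∈ Finset.univ.erase (h c), (quo m' j ^ 2 + quo m' j)
      = ∑ j ∈ Finset.univ.erase (h c), (quo m j ^ 2 + quo m j) :=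
    Finset.sum_congr rfl fun j hj => by rw [hq j (Finset.ne_of_mem_erase hj)]
  obtain ⟨b1, b2⟩ := hg.surplus_bounds
  have key := potential_change (N := n) (a := quo m (h c)) (by positivity) (by ring) hS b1 b2
  rw [hpot m, hpot m', hrest]
  refine ⟨hg, by nlinarith, fun he => ?_⟩
  have hzero : quo m (h c) - quo m' (h c) = 0 := by
    by_contra hne
    have : 0 < (quo m (h c) - quo m' (h c)) ^ 2 := by positivity
    linarith
  refine ⟨funext fun l => ?_, by rw [hS, hzero, add_zero]⟩
  by_cases hl : l = h c
  · rw [hl]; linarith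
  · exact hq l hl

/-- By monotonicity, equal potentials at both ends force equality at each step in between, so
nothing changes on the way. -/
theorem Gathered.run {H : ℕ → Fin n → Fin n} {x : ℕ → Mass n} {k t : ℕ} {c : Fin n}
    (h : Gathered (x k) c) (hx : ∀ s, k ≤ s → s < k + t → Drive (H s) (x s) (x (s + 1))) :
    Gathered (x (k + t)) (walk H k t c) ∧ potential (x (k + t)) ≤ potential (x k) ∧
      (potential (x (k + t)) = potential (x k) →
        quo (x (k + t)) = quo (x k) ∧ surplus (x (k + t)) = surplus (x k)) := by
  induction t with
  | zero => exact ⟨h, le_rfl, fun _ => ⟨rfl, rfl⟩⟩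
  | succ t ih =>
    obtain ⟨h1, h2, h3⟩ := ih fun s h1 h2 => hx s h1 (by omega)
    obtain ⟨h4, h5, h6⟩ := h1.drive (hx (k + t) (by omega) (by omega))
    refine ⟨h4, h5.trans h2, fun he => ?_⟩
    rw [← add_assoc] at he
    obtain ⟨h7, h8⟩ := h6 (le_antisymm h5 (by linarith))
    obtain ⟨h9, h10⟩ := h3 (le_antisymm h2 (by linarith))
    exact ⟨h7.trans h9, h8.trans h10⟩

/-- If two kept sizes differ, the upper bound at the minimum `F` and the lower bound at a larger one
pin `S` to `n (F + 1)`. Then no kept size exceeds `F + 1`. -/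
theorem Gathered.settled {m : Mass n} {c : Fin n} (h : Gathered m c)
    (hs : ∀ v, n * quo m v ≤ surplus m ∧ surplus m ≤ n * quo m v + n) : ∃ F, Settled F m := by
  have hn : (0 : ℤ) < n := by exact_mod_cast c.pos
  obtain ⟨u, -, hu⟩ := Finset.exists_min_image Finset.univ (quo m) ⟨c, Finset.mem_univ c⟩
  refine ⟨quo m u, ?_⟩
  by_cases hall : ∀ j, quo m j = quo m u
  · exact Or.inl hall
  · right
    push Not at hall
    obtain ⟨w, hw⟩ := hall
    have hlt : quo m u + 1 ≤ quo m w := lt_of_le_of_ne (hu w (Finset.mem_univ w)) (Ne.symm hw)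
    have hS : surplus m = n * (quo m u + 1) := by
      refine le_antisymm (by linarith [(hs u).2]) ?_
      exact (mul_le_mul_of_nonneg_left hlt hn.le).trans (hs w).1
    intro j
    have hj1 := hu j (Finset.mem_univ j)
    have hj2 : quo m j ≤ quo m u + 1 := by
      refine le_of_mul_le_mul_left ?_ hn
      rw [← hS]; exact (hs j).1
    refine ⟨by omega, ?_⟩
    rw [h.y_eq j, h j]
    split_ifs
    · rw [hS]; push_cast; ring
    · push_cast; ring

/-! ### Gathering the walking pieces -/

/-- From the node `j` there is a path of `k` edges to `c`. -/
def PathTo (G : Digraph (Fin n)) (c : Fin n) : ℕ → Fin n → Prop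
  | 0, j => j = c
  | k + 1, j => ∃ l, G.Adj j l ∧ PathTo G c k l

/-- Next nodes on the way to the targets `c`, with ranks that decrease on the way. -/
theorem exists_parent {G : Digraph (Fin n)} (hG : StronglyConnected G) :
    ∃ (par : Fin n → Fin n → Fin n) (rk : Fin n → Fin n → ℕ), (∀ c, rk c c = 0) ∧
      ∀ c j, j ≠ c → G.Adj j (par c j) ∧ rk c (par c j) < rk c j := by
  classical
  have hex : ∀ c j, ∃ k, PathTo G c k j := by
    intro c j
    by_cases hj : j = c
    · exact ⟨0, hj⟩
    · induction hG j c hj using Relation.TransGen.head_induction_on with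
      | single h => exact ⟨1, c, h, rfl⟩
      | head h _ ih =>
        rename_i a b _
        by_cases hb : b = c
        · exact ⟨1, b, h, hb⟩
        · obtain ⟨k, hk⟩ := ih hb
          exact ⟨k + 1, b, h, hk⟩
  -- The rank is the length of a shortest path to `c`; the second node of such a path is strictly
  -- closer.
  have hpar : ∀ c j, ∃ l, j ≠ c → G.Adj j l ∧ Nat.find (hex c l) < Nat.find (hex c j) := by
    intro c j
    by_cases hj : j = c
    · exact ⟨c, fun h => absurd hj h⟩
    · have hspec := Nat.find_spec (hex c j)
      rcases hk : Nat.find (hex c j) with _ | k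
      · rw [hk] at hspec
        exact absurd hspec hj
      · rw [hk] at hspec
        obtain ⟨l, h1, h2⟩ := hspec
        exact ⟨l, fun _ => ⟨h1, Nat.lt_succ_of_le (Nat.find_min' _ h2)⟩⟩
  choose par hpar using hpar
  exact ⟨par, fun c j => Nat.find (hex c j), fun c => (Nat.find_eq_zero _).2 rfl, hpar⟩

/-- Every edge of the nominal digraph is present at some time of every interval of length `L`. -/
def EdgesRecur (G : ℕ → Digraph (Fin n)) (Gnom : Digraph (Fin n)) (L : ℕ) : Prop :=
  ∀ k u v, Gnom.Adj u v → ∃ s, k ≤ s ∧ s < k + L ∧ (G s).Adj u v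

/-- Windows are shorter than `l`, so any interval of length `2 * l` contains a whole one. -/
theorem JointlyNominal.edgesRecur {G : ℕ → Digraph (Fin n)} {Gnom : Digraph (Fin n)}
    (h : JointlyNominal G Gnom) : ∃ L, 0 < L ∧ EdgesRecur G Gnom L := by
  obtain ⟨-, l, t, ht0, ht⟩ := h
  have hl : 0 < l := by have := ht 0; omega
  have hmono : ∀ m, m ≤ t m := by
    intro m
    induction m with
    | zero => omega
    | succ m ih => have := (ht m).1; omega
  refine ⟨2 * l, by omega, fun k u v huv => ?_⟩
  have hex : ∃ m, k ≤ t m := ⟨k, hmono k⟩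
  classical
  obtain ⟨m, hm1, hm2⟩ : ∃ m, k ≤ t m ∧ t m < k + l := by
    refine ⟨Nat.find hex, Nat.find_spec hex, ?_⟩
    rcases hf : Nat.find hex with _ | m
    · omega
    · have h1 := Nat.find_min hex (m := m) (by omega)
      have h2 := (ht m).2.1
      omega
  obtain ⟨-, h2, h3⟩ := ht m
  rw [← h3, unionGraph] at huv
  simp only [Digraph.iSup_adj, Set.mem_Ico] at huv
  obtain ⟨s, ⟨hs1, hs2⟩, hs⟩ := huv
  exact ⟨s, by omega, by omega, hs⟩

open Classical in
/-- Move to the next node on the way to `c` whenever the edge is present. -/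
noncomputable def hop (G : Digraph (Fin n)) (par : Fin n → Fin n → Fin n) (c j : Fin n) : Fin n :=
  if j ≠ c ∧ G.Adj j (par c j) then par c j else j

theorem hop_eq_or_adj (G : Digraph (Fin n)) (par : Fin n → Fin n → Fin n) (c j : Fin n) :
    hop G par c j = j ∨ G.Adj j (hop G par c j) := by
  unfold hop
  split_ifs with h
  · exact Or.inr h.2
  · exact Or.inl rfl

/-- Within `L` steps a walker off the target lowers its rank: until it moves it waits at `u`, and
the edge to its parent appears in that time. `D` such stretches exhaust the rank. -/
theorem walk_eq_target {G : ℕ → Digraph (Fin n)} {Gnom : Digraph (Fin n)} {L : ℕ}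
    (hL : EdgesRecur G Gnom L) {par : Fin n → Fin n → Fin n} {rk : Fin n → Fin n → ℕ}
    (hrk : ∀ c, rk c c = 0)
    (hpar : ∀ c j, j ≠ c → Gnom.Adj j (par c j) ∧ rk c (par c j) < rk c j)
    {H : ℕ → Fin n → Fin n} {c : Fin n} (D k : ℕ) (u : Fin n) (hu : rk c u ≤ D)
    (hH : ∀ s, k ≤ s → s < k + D * L → H s = hop (G s) par c) : walk H k (D * L) u = c := by
  induction D generalizing k u with
  | zero =>
    rw [zero_mul]
    by_contra hne
    have := (hpar c u hne).2
    omega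
  | succ D ih =>
    have hHL : ∀ t < L, H (k + t) = hop (G (k + t)) par c := fun t ht =>
      hH _ (by omega) (by rw [add_mul, one_mul]; omega)
    have hstep : ∀ s v, hop (G s) par c v = v ∨ rk c (hop (G s) par c v) < rk c v := by
      intro s v
      unfold hop
      split_ifs with h
      · exact Or.inr (hpar c v h.1).2
      · exact Or.inl rfl
    have hinv : ∀ t ≤ L, walk H k t u = u ∨ rk c (walk H k t u) < rk c u := by
      intro t
      induction t with
      | zero => exact fun _ => Or.inl rfl
      | succ t iht =>
        intro ht
        simp only [walk, hHL t (by omega)]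
        rcases hstep (k + t) (walk H k t u) with h | h
        · rw [h]; exact iht (by omega)
        · right
          rcases iht (by omega) with h' | h'
          · rw [h'] at h ⊢; exact h
          · exact h.trans h'
    rw [show (D + 1) * L = L + D * L by ring, walk_add]
    refine ih (k + L) _ ?_ fun s h1 h2 => hH s (by omega) (by rw [add_mul, one_mul]; omega)
    rcases hinv L le_rfl with h | h
    · rw [h]
      by_cases huc : u = c
      · rw [huc, hrk]; omega
      · exfalso
        obtain ⟨s, hs1, hs2, hs⟩ := hL k u (par c u) (hpar c u huc).1
        obtain ⟨t, rfl⟩ := Nat.exists_eq_add_of_le hs1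
        have hlt : ∀ t', t + 1 ≤ t' → t' ≤ L → rk c (walk H k t' u) < rk c u := by
          intro t' ht'
          induction t', ht' using Nat.le_induction with
          | base =>
            intro ht'
            simp only [walk, hHL t (by omega)]
            rcases hinv t (by omega) with h' | h'
            · rw [h', hop, if_pos ⟨huc, hs⟩]; exact (hpar c u huc).2
            · rcases hstep (k + t) (walk H k t u) with h'' | h''
              · rw [h'']; exact h'
              · exact h''.trans h'
          | succ t' _ ih' =>
            intro ht''
            simp only [walk, hHL t' (by omega)]
            rcases hstep (k + t') (walk H k t' u) with h'' | h''
            · rw [h'']; exact ih' (by omega)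
            · exact h''.trans (ih' (by omega))
        have := hlt L (by omega) le_rfl
        rw [h] at this
        exact lt_irrefl _ this
    · omega

/-! ### The strategy that visits all nodes in turn -/

/-- The maps `H` follow the digraphs, and in the `q`-th time interval of length `T₀` they take all
walkers to the node `q % n`. -/
structure IsTour (G : ℕ → Digraph (Fin n)) (hn : 0 < n) (H : ℕ → Fin n → Fin n) (T₀ : ℕ) :
    Prop where
  eq_or_adj : ∀ s j, H s j = j ∨ (G s).Adj j (H s j)
  walk_eq : ∀ q j, walk H (q * T₀) T₀ j = ⟨q % n, Nat.mod_lt q hn⟩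

theorem JointlyNominal.exists_isTour {G : ℕ → Digraph (Fin n)} {Gnom : Digraph (Fin n)}
    (h : JointlyNominal G Gnom) (hn : 0 < n) :
    ∃ (H : ℕ → Fin n → Fin n) (T₀ : ℕ), IsTour G hn H T₀ := by
  obtain ⟨L, hL0, hL⟩ := h.edgesRecur
  obtain ⟨par, rk, hrk, hpar⟩ := exists_parent h.1
  -- The `+ 1` keeps the block length `D * L` positive, so that `s / (D * L)` is the index of the
  -- block containing `s`.
  let D := ∑ c, ∑ j, rk c j + 1
  have hD : ∀ c j, rk c j ≤ D := fun c j =>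
    ((Finset.single_le_sum (fun _ _ => Nat.zero_le _) (Finset.mem_univ j)).trans
      (Finset.single_le_sum (f := fun c => ∑ j, rk c j) (fun _ _ => Nat.zero_le _)
        (Finset.mem_univ c))).trans (Nat.le_succ _)
  have hT : 0 < D * L := Nat.mul_pos (Nat.succ_pos _) hL0
  refine ⟨fun s => hop (G s) par ⟨s / (D * L) % n, Nat.mod_lt _ hn⟩, D * L,
    fun s j => hop_eq_or_adj _ _ _ _, fun q j => ?_⟩
  refine walk_eq_target hL hrk hpar D _ j (hD _ _) fun s h1 h2 => ?_
  have : s / (D * L) = q := by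
    rw [Nat.div_eq_iff hT]
    omega
  simp only [this]

theorem IsTour.gathered_block {G : ℕ → Digraph (Fin n)} {hn : 0 < n} {H : ℕ → Fin n → Fin n}
    {T₀ : ℕ} (hH : IsTour G hn H T₀) {x : ℕ → Mass n} {q : ℕ}
    (hx : ∀ s, q * T₀ ≤ s → s < q * T₀ + T₀ → Drive (H s) (x s) (x (s + 1)))
    (hz : ∀ j, 1 ≤ (x (q * T₀)).z j) (hsum : ∑ j, (x (q * T₀)).z j = 2 * n) :
    Gathered (x (q * T₀ + T₀)) ⟨q % n, Nat.mod_lt q hn⟩ := by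
  intro l
  rw [z_sub_one_eq_of_drive hx hz]
  simp only [hH.walk_eq, eq_comm (b := l)]
  split_ifs
  · have h1 : ∑ j, ((x (q * T₀)).z j - 1) + ∑ _j : Fin n, 1 = ∑ j, (x (q * T₀)).z j := by
      rw [← Finset.sum_add_distrib]
      exact Finset.sum_congr rfl fun j _ => Nat.sub_add_cancel (hz j)
    rw [hsum] at h1
    simp only [Finset.sum_const, Finset.card_univ, Fintype.card_fin, smul_eq_mul, mul_one] at h1
    omega
  · simp

/-- During `n` blocks the walkers visit every node `v`. If the potential ends no lower, kept sizes
and surplus never changed, so the bounds of `surplus_bounds` on arrival at `v` hold for the initial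
mass. -/
theorem IsTour.settled_or_potential_lt {G : ℕ → Digraph (Fin n)} {hn : 0 < n}
    {H : ℕ → Fin n → Fin n} {T₀ : ℕ} (hH : IsTour G hn H T₀) {x : ℕ → Mass n} {q : ℕ} {c : Fin n}
    (hx : ∀ s, q * T₀ ≤ s → s < q * T₀ + n * T₀ → Drive (H s) (x s) (x (s + 1)))
    (hc : Gathered (x (q * T₀)) c) :
    (∃ F, Settled F (x (q * T₀))) ∨
      potential (x (q * T₀ + n * T₀)) < potential (x (q * T₀)) := by
  rw [or_iff_not_imp_right, not_lt]
  intro hle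
  refine hc.settled fun v => ?_
  obtain ⟨b, hb, hbv⟩ : ∃ b < n, (q + b) % n = v := by
    -- This is `v - q` modulo `n`, written without truncated subtraction.
    refine ⟨(v + (n - q % n)) % n, Nat.mod_lt _ hn, ?_⟩
    have h1 := Nat.mod_lt q hn
    have h2 := Nat.mod_add_div q n
    rw [Nat.add_mod_mod, show q + (v + (n - q % n)) = v + n + n * (q / n) by omega,
      Nat.add_mul_mod_self_left, Nat.add_mod_right, Nat.mod_eq_of_lt v.isLt]
  have hbT : b * T₀ + T₀ ≤ n * T₀ := by
    rw [← Nat.succ_mul]; exact Nat.mul_le_mul_right _ hb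
  have hmid := hc.run (t := b * T₀ + T₀) fun s h1 h2 => hx s h1 (by omega)
  obtain ⟨r, hr⟩ := Nat.exists_eq_add_of_le hbT
  have hend := hmid.1.run (t := r) fun s h1 h2 => hx s (by omega) (by omega)
  rw [show q * T₀ + (b * T₀ + T₀) + r = q * T₀ + n * T₀ by omega] at hend
  obtain ⟨h1, h2⟩ := hmid.2.2 (le_antisymm hmid.2.1 (hle.trans hend.2.1))
  have hw : walk H (q * T₀) (b * T₀ + T₀) c = v := by
    rw [walk_add, ← add_mul, hH.walk_eq]
    exact Fin.ext hbv
  have h3 := hmid.1.surplus_bounds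
  rwa [hw, h1, h2] at h3

theorem Gathered.potential_le {m : Mass n} {c : Fin n} (h : Gathered m c) {y₀ : Fin n → ℤ} {B : ℤ}
    (hm : Reachable y₀ B m) : potential m ≤ n * (n * (B ^ 2 + B)) + (n * B + n) ^ 2 := by
  have h1 : ∀ j, -B ≤ quo m j := fun j => le_quo (hm.pos j) (hm.le_y j)
  have h2 : ∀ j, quo m j ≤ B := fun j =>
    (quo_le_piece m j 0).trans (piece_le (hm.pos j) (hm.y_le j) 0)
  have hn : (0 : ℤ) ≤ n := by positivity
  obtain ⟨b1, b2⟩ := h.surplus_bounds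
  have hS : surplus m ^ 2 ≤ (n * B + n) ^ 2 := by
    refine sq_le_sq' ?_ ?_
    · nlinarith [h1 c]
    · nlinarith [h2 c]
  have hq : ∑ j, (quo m j ^ 2 + quo m j) ≤ n * (B ^ 2 + B) := by
    have : ∑ j, (quo m j ^ 2 + quo m j) ≤ ∑ _j : Fin n, (B ^ 2 + B) :=
      Finset.sum_le_sum fun j _ => by nlinarith [h1 j, h2 j]
    simpa using this
  unfold potential
  gcongr

theorem IsTour.exists_settled {G : ℕ → Digraph (Fin n)} {hn : 0 < n}
    {H : ℕ → Fin n → Fin n} {T₀ : ℕ} (hH : IsTour G hn H T₀) (B : ℤ) :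
    ∃ T, ∀ (y₀ : Fin n → ℤ) (x : ℕ → Mass n) (M : ℕ), (∀ s, Reachable y₀ B (x s)) →
      (∀ s, M * T ≤ s → s < M * T + T → Drive (H s) (x s) (x (s + 1))) →
      ∃ s ≤ M * T + T, ∃ F, Settled F (x s) := by
  obtain ⟨K, hK⟩ := Int.eq_ofNat_of_zero_le
    (Int.le_max_right (n * (n * (B ^ 2 + B)) + (n * B + n) ^ 2) 0)
  -- One block gathers the walkers. Then `K + 1` rounds of `n` blocks would each lower a potential
  -- that starts at most `K`, making it negative unless a settled mass occurs.
  refine ⟨(1 + n * (K + 1)) * T₀, fun y₀ x M hm hx => ?_⟩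
  set q₀ := M * (1 + n * (K + 1)) with hq₀
  have hstart : M * ((1 + n * (K + 1)) * T₀) = q₀ * T₀ := by rw [hq₀]; ring
  rw [hstart] at hx ⊢
  have hbound : ∀ a ≤ K + 1, (q₀ + 1 + n * a) * T₀ ≤ q₀ * T₀ + (1 + n * (K + 1)) * T₀ := by
    intro a ha
    rw [← add_mul, ← add_assoc]
    gcongr
  have hend : ∀ a, (q₀ + 1 + n * a) * T₀ + n * T₀ = (q₀ + 1 + n * (a + 1)) * T₀ := by
    intro a; ring
  have hbegin : ∀ a, q₀ * T₀ ≤ (q₀ + 1 + n * a) * T₀ := by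
    intro a
    gcongr
    omega
  by_contra hno
  push Not at hno
  have key : ∀ a ≤ K + 1, (∃ c, Gathered (x ((q₀ + 1 + n * a) * T₀)) c) ∧
      potential (x ((q₀ + 1 + n * a) * T₀)) ≤ K - a := by
    intro a
    induction a with
    | zero =>
      intro _
      have h1 := hH.gathered_block (q := q₀) (x := x)
        (fun s h1 h2 => hx s h1 (by have := hbound 0 (by omega); rw [mul_zero] at this; nlinarith))
        (hm _).pos (hm _).sum_z
      rw [show q₀ * T₀ + T₀ = (q₀ + 1 + n * 0) * T₀ by ring] at h1
      refine ⟨⟨_, h1⟩, ?_⟩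
      have := h1.potential_le (hm _)
      have := le_max_left (n * (n * (B ^ 2 + B)) + (n * B + n) ^ 2) 0
      push_cast
      omega
    | succ a ih =>
      intro ha
      obtain ⟨⟨c, hc⟩, h2⟩ := ih (by omega)
      have hdrive : ∀ s, (q₀ + 1 + n * a) * T₀ ≤ s → s < (q₀ + 1 + n * a) * T₀ + n * T₀ →
          Drive (H s) (x s) (x (s + 1)) := fun s h1 h2 =>
        hx s ((hbegin a).trans h1) (h2.trans_le ((hend a).trans_le (hbound (a + 1) ha)))
      have h3 := (hc.run hdrive).1
      rw [hend] at h3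
      refine ⟨⟨_, h3⟩, ?_⟩
      rcases hH.settled_or_potential_lt hdrive hc with ⟨F, hF⟩ | h4
      · exact absurd hF (hno _ (hbound a (by omega)) F)
      · rw [hend] at h4
        push_cast
        omega
  have h1 := (key (K + 1) le_rfl).2
  have h2 := potential_nonneg (x ((q₀ + 1 + n * (K + 1)) * T₀))
  push_cast at h1
  omega

/-! ### Probabilities of the draws -/

theorem le_transProb (G : Digraph (Fin n)) {l j : Fin n} (h : l = j ∨ G.Adj j l) :
    1 / (1 + (n : ℝ)) ≤ transProb G l j := by
  have hl : l = j ∨ l ∈ outNbrs G j := by simpa [outNbrs] using h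
  have hcard : (outNbrs G j).card ≤ n := by
    simpa using Finset.card_le_univ (outNbrs G j)
  rw [transProb, if_pos hl]
  gcongr

/-- Forbidden draws have probability zero and there are countably many of them, so the pathwise
invariants hold almost surely. -/
theorem IsDraws.ae_feasible {G : ℕ → Digraph (Fin n)} {Ω : Type*} [MeasurableSpace Ω]
    {P : Measure Ω} [IsProbabilityMeasure P] {ξ : ℕ → Fin n → ℕ → Ω → Fin n}
    (h : IsDraws G P ξ) : ∀ᵐ ω ∂P, ∀ k, Feasible (G k) (fun j i => ξ k j i ω) := by
  simp only [Feasible, ae_all_iff]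
  intro k j i
  have h0 : ∀ l, ¬ (l = j ∨ (G k).Adj j l) → ∀ᵐ ω ∂P, ξ k j i ω ≠ l := by
    intro l hl
    have h1 : P.real {ω | ξ k j i ω = l} = 0 := by
      rw [h.law, transProb, if_neg (by simpa [outNbrs] using hl)]
    rw [measureReal_eq_zero_iff] at h1
    simpa [ae_iff] using h1
  have h2 : ∀ᵐ ω ∂P, ∀ l, ¬ (l = j ∨ (G k).Adj j l) → ξ k j i ω ≠ l := by
    rw [ae_all_iff]
    intro l
    by_cases hl : l = j ∨ (G k).Adj j l
    · exact Filter.Eventually.of_forall fun _ h => absurd hl h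
    · filter_upwards [h0 l hl] with ω hω _ using hω
  filter_upwards [h2] with ω hω
  by_contra hne
  exact hω _ hne rfl

/-- The draws in the time interval `[M * T, M * T + T)` that can matter. -/
def blockDraws (n T M : ℕ) : Finset (ℕ × Fin n × ℕ) :=
  Finset.Ico (M * T) (M * T + T) ×ˢ Finset.univ ×ˢ Finset.range (2 * n)

theorem card_blockDraws (n T M : ℕ) : (blockDraws n T M).card = T * (n * (2 * n)) := by
  simp [blockDraws]

theorem pairwiseDisjoint_blockDraws (n T : ℕ) :
    Pairwise fun M M' => Disjoint (blockDraws n T M) (blockDraws n T M') := by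
  intro M M' hne
  rw [Finset.disjoint_left]
  rintro ⟨s, j, i⟩ h h'
  simp only [blockDraws, Finset.mem_product, Finset.mem_Ico] at h h'
  rcases lt_or_gt_of_ne hne with hlt | hlt
  · have := Nat.mul_le_mul_right T (Nat.succ_le_of_lt hlt)
    rw [Nat.succ_mul] at this
    omega
  · have := Nat.mul_le_mul_right T (Nat.succ_le_of_lt hlt)
    rw [Nat.succ_mul] at this
    omega

/-- The draws in the time interval `[M * T, M * T + T)` follow the maps `H`. -/
def followEvent {Ω : Type*} (ξ : ℕ → Fin n → ℕ → Ω → Fin n) (H : ℕ → Fin n → Fin n) (T M : ℕ) :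
    Set Ω :=
  ⋂ a ∈ blockDraws n T M, (fun ω => ξ a.1 a.2.1 a.2.2 ω) ⁻¹' {H a.1 a.2.1}

section

variable {G : ℕ → Digraph (Fin n)} {Ω : Type*} [MeasurableSpace Ω] {P : Measure Ω}
  {ξ : ℕ → Fin n → ℕ → Ω → Fin n}

theorem IsDraws.measurableSet_followEvent (h : IsDraws G P ξ) (H : ℕ → Fin n → Fin n) (T M : ℕ) :
    MeasurableSet (followEvent ξ H T M) :=
  Finset.measurableSet_biInter _ fun _ _ => h.measurable _ _ _ (measurableSet_singleton _)

theorem IsDraws.measure_followEvent (h : IsDraws G P ξ) (H : ℕ → Fin n → Fin n) (T M : ℕ) :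
    P (followEvent ξ H T M) = ∏ a ∈ blockDraws n T M,
      P ((fun ω => ξ a.1 a.2.1 a.2.2 ω) ⁻¹' {H a.1 a.2.1}) :=
  h.indep.measure_inter_preimage_eq_mul _ (sets := fun a => {H a.1 a.2.1})
    fun _ _ => measurableSet_singleton _

/-- The events are determined by disjoint sets of independent draws. -/
theorem IsDraws.iIndepSet_followEvent (h : IsDraws G P ξ) (H : ℕ → Fin n → Fin n) (T : ℕ) :
    iIndepSet (followEvent ξ H T) P := by
  classical
  rw [iIndepSet_iff_meas_biInter fun M => h.measurableSet_followEvent H T M]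
  intro S
  have h1 : ⋂ M ∈ S, followEvent ξ H T M = ⋂ a ∈ S.biUnion (blockDraws n T),
      (fun ω => ξ a.1 a.2.1 a.2.2 ω) ⁻¹' {H a.1 a.2.1} := by
    simp only [followEvent, Finset.set_biInter_biUnion]
  rw [h1, h.indep.measure_inter_preimage_eq_mul _ (sets := fun a => {H a.1 a.2.1})
    fun _ _ => measurableSet_singleton _,
    Finset.prod_biUnion fun M _ M' _ hne => pairwiseDisjoint_blockDraws n T hne]
  exact Finset.prod_congr rfl fun M _ => (h.measure_followEvent H T M).symm

theorem IsDraws.le_measureReal_followEvent (h : IsDraws G P ξ) {H : ℕ → Fin n → Fin n}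
    (hH : ∀ s j, H s j = j ∨ (G s).Adj j (H s j)) (T M : ℕ) :
    (1 / (1 + (n : ℝ))) ^ (T * (n * (2 * n))) ≤ P.real (followEvent ξ H T M) := by
  rw [measureReal_def, h.measure_followEvent, ENNReal.toReal_prod, ← card_blockDraws n T M,
    ← Finset.prod_const]
  refine Finset.prod_le_prod (fun _ _ => by positivity) fun a _ => ?_
  exact (le_transProb (G a.1) (hH a.1 a.2.1)).trans_eq (h.law a.1 a.2.1 a.2.2 _).symm

theorem IsDraws.measureReal_biInter_compl_le [IsProbabilityMeasure P] (h : IsDraws G P ξ)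
    {H : ℕ → Fin n → Fin n} (hH : ∀ s j, H s j = j ∨ (G s).Adj j (H s j)) (T N : ℕ) :
    P.real (⋂ M ∈ Finset.range N, (followEvent ξ H T M)ᶜ) ≤
      (1 - (1 / (1 + (n : ℝ))) ^ (T * (n * (2 * n)))) ^ N := by
  -- Independence of the generated σ-algebras also covers the complements.
  have hi : iIndep (fun M => MeasurableSpace.generateFrom {followEvent ξ H T M}) P :=
    h.iIndepSet_followEvent H T
  rw [measureReal_def, hi.meas_biInter fun M _ =>
    (MeasurableSpace.measurableSet_generateFrom (Set.mem_singleton _)).compl, ENNReal.toReal_prod]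
  conv_rhs => rw [← Finset.card_range N, ← Finset.prod_const]
  refine Finset.prod_le_prod (fun _ _ => ENNReal.toReal_nonneg) fun M _ => ?_
  rw [← measureReal_def, probReal_compl_eq_one_sub (h.measurableSet_followEvent H T M)]
  exact sub_le_sub_left (h.le_measureReal_followEvent hH T M) _

end

/-! ### Combining the pathwise argument with the block estimate -/

theorem initError_nonneg (y₀ : Fin n → ℤ) : 0 ≤ initError y₀ :=
  add_nonneg (Finset.sum_nonneg fun _ hj => (sub_pos.2 (Finset.mem_filter.1 hj).2).le)
    (Finset.sum_nonneg fun _ hj => (sub_pos.2 (Finset.mem_filter.1 hj).2).le)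

theorem qState_eventually_const (hn : 0 < n) {G : ℕ → Digraph (Fin n)}
    (hG : ∀ k, NoSelfEdges (G k)) {y₀ : Fin n → ℤ} {B : ℤ} (hB : ∀ j, |y₀ j| ≤ B)
    {d : ℕ → Fin n → ℕ → Fin n} (hd : ∀ k, Feasible (G k) (d k)) {F : ℤ} {s : ℕ}
    (hs : Settled F (mass G y₀ d s)) (j : Fin n) :
    (∀ k ≥ s, qState G y₀ d k j = ⌊average y₀⌋) ∨ ∀ k ≥ s, qState G y₀ d k j = ⌈average y₀⌉ := by
  have hm := reachable_mass hG hB hd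
  have hz : ∀ k j, 1 ≤ (mass G y₀ d k).z j := fun k => (hm k).pos
  have hq : ∀ k ≥ s, qState G y₀ d k j = quo (mass G y₀ d s) j := fun k hk => by
    rw [qState_eq_quo hG hd hz, (hs.mass_of_le hG hd hz hk).2]
  exact (hs.quo_eq_floor_or_ceil hn (hm s) j).imp (fun h k hk => (hq k hk).trans h)
    fun h k hk => (hq k hk).trans h

/-- No node ever holds more than the `2n` pieces in total, so prescribing the first `2n` draws fixes
the step without knowing the current mass. -/
theorem drive_mass {G : ℕ → Digraph (Fin n)} (hG : ∀ k, NoSelfEdges (G k)) {y₀ : Fin n → ℤ}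
    {B : ℤ} {d : ℕ → Fin n → ℕ → Fin n} (hd : ∀ k, Feasible (G k) (d k)) {k : ℕ}
    (hm : Reachable y₀ B (mass G y₀ d k)) {h : Fin n → Fin n}
    (hh : ∀ j, ∀ i < 2 * n, d k j i = h j) :
    Drive h (mass G y₀ d k) (mass G y₀ d (k + 1)) := by
  refine drive_nextMass (hG k) hm.pos (hd k) fun j i hi => hh j i ?_
  have := Finset.single_le_sum (f := (mass G y₀ d k).z) (fun _ _ => Nat.zero_le _)
    (Finset.mem_univ j)
  rw [hm.sum_z] at this
  omega

/-- The states settle before a deterministic time with probability as close to one as desired. -/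
theorem exists_time_of_lt_one {n : ℕ} (hn : 0 < n)
    (G : ℕ → Digraph (Fin n)) (hG : ∀ k, NoSelfEdges (G k))
    (Gnom : Digraph (Fin n)) (hA2 : JointlyNominal G Gnom)
    (y₀ : Fin n → ℤ) {c : ℝ} (hc : c < 1) :
    ∃ k₀ : ℕ, ∀ (Ω : Type*) [MeasurableSpace Ω] (P : Measure Ω) [IsProbabilityMeasure P]
      (ξ : ℕ → Fin n → ℕ → Ω → Fin n), IsDraws G P ξ →
      c ≤ P.real {ω | ∀ j : Fin n,
          (∀ k ≥ k₀, qState G y₀ (fun k j i => ξ k j i ω) k j = ⌊average y₀⌋) ∨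
          (∀ k ≥ k₀, qState G y₀ (fun k j i => ξ k j i ω) k j = ⌈average y₀⌉)} := by
  obtain ⟨H, T₀, hH⟩ := hA2.exists_isTour hn
  obtain ⟨T, hT⟩ := hH.exists_settled (∑ j, |y₀ j|)
  have hB : ∀ j, |y₀ j| ≤ ∑ j, |y₀ j| := fun j =>
    Finset.single_le_sum (f := fun j => |y₀ j|) (fun _ _ => abs_nonneg _) (Finset.mem_univ j)
  have hp : 0 < (1 / (1 + (n : ℝ))) ^ (T * (n * (2 * n))) := by positivity
  obtain ⟨N, hN⟩ := exists_pow_lt_of_lt_one (sub_pos.2 hc)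
    (sub_lt_self 1 hp : 1 - (1 / (1 + (n : ℝ))) ^ (T * (n * (2 * n))) < 1)
  refine ⟨N * T, fun Ω _ P _ ξ hξ => ?_⟩
  have hmeas : MeasurableSet (⋂ M ∈ Finset.range N, (followEvent ξ H T M)ᶜ) :=
    Finset.measurableSet_biInter _ fun M _ => (hξ.measurableSet_followEvent H T M).compl
  have h1 : c ≤ P.real (⋂ M ∈ Finset.range N, (followEvent ξ H T M)ᶜ)ᶜ := by
    rw [probReal_compl_eq_one_sub hmeas]
    linarith [hξ.measureReal_biInter_compl_le hH.eq_or_adj T N]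
  -- Almost-everywhere inclusion suffices, so measurability of the target event is not needed.
  refine h1.trans (ENNReal.toReal_mono (measure_ne_top _ _) (measure_mono_ae ?_))
  filter_upwards [hξ.ae_feasible] with ω hd hω j
  simp only [Set.compl_iInter, compl_compl] at hω
  obtain ⟨M, hM⟩ := Set.mem_iUnion.1 hω
  obtain ⟨hMN, hM⟩ := Set.mem_iUnion.1 hM
  have hMN' := Nat.mul_le_mul_right T (Nat.succ_le_of_lt (Finset.mem_range.1 hMN))
  rw [Nat.succ_mul] at hMN'
  have hm := reachable_mass hG hB hd
  obtain ⟨s, hs, F, hF⟩ := hT y₀ (mass G y₀ fun k j i => ξ k j i ω) M hm fun s h1 h2 => by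
    refine drive_mass hG hd (hm s) fun j i hi => ?_
    simp only [followEvent, Set.mem_iInter] at hM
    exact hM ⟨s, j, i⟩ (by simp [blockDraws, h1, h2, hi])
  exact (qState_eventually_const hn hG hB hd hF j).imp (fun h k hk => h k (by omega))
    fun h k hk => h k (by omega)

end QuantAvg

theorem theorem2 {n : ℕ} (hn : 2 ≤ n)
    (G : ℕ → Digraph (Fin n)) (hG : ∀ k, QuantAvg.NoSelfEdges (G k))
    (Gnom : Digraph (Fin n)) (hA2 : QuantAvg.JointlyNominal G Gnom)
    (y₀ : Fin n → ℤ) (ε : ℝ) (hε0 : 0 < ε) (hε1 : ε < 1) :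
    ∃ k₀ : ℕ, ∀ (Ω : Type*) [MeasurableSpace Ω] (P : Measure Ω) [IsProbabilityMeasure P]
      (ξ : ℕ → Fin n → ℕ → Ω → Fin n), QuantAvg.IsDraws G P ξ →
      (1 - ε) ^ (QuantAvg.initError y₀ + (n : ℤ)) ≤
        P.real {ω | ∀ j : Fin n,
          (∀ k ≥ k₀, QuantAvg.qState G y₀ (fun k j i => ξ k j i ω) k j
            = ⌊QuantAvg.average y₀⌋) ∨
          (∀ k ≥ k₀, QuantAvg.qState G y₀ (fun k j i => ξ k j i ω) k j
            = ⌈QuantAvg.average y₀⌉)} := by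
  -- It remains to see that the bound is below 1: its exponent is a natural number, nonzero because
  -- `n ≥ 2`.
  refine QuantAvg.exists_time_of_lt_one (by omega) G hG Gnom hA2 y₀ ?_
  obtain ⟨e, he⟩ := Int.eq_ofNat_of_zero_le (QuantAvg.initError_nonneg y₀)
  rw [he, ← Nat.cast_add, zpow_natCast]
  exact pow_lt_one₀ (by linarith) (by linarith) (by omega)
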